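/- Let $d,n\ge 1$ and $N,k,N_g\ge 0$ be integers. Let $\hat U(\theta)=\prod_{l=1}^{N_g}\hat u_l(\theta)$, $\theta\in\Theta$, be a parametrized circuit on $N$ qudits of dimension $d$, in which every gate $\hat u_l(\theta)$ is a unitary acting on at most $k$ qudits (the set of qudits of the $l$-th gate does not depend on $\theta$), and all but $N_{gt}\le N_g$ of the gates are fixed, i.e. independent of $\theta$. Let $O$ be a Hermitian observable on $(\mathbb C^d)^{\otimes N}$ with operator norm $\|O\|$, let $x\mapsto\rho_x$ be a measurable encoding of the data $x\in\mathcal X$ into density operators, and let $h_\theta(x)=\operatorname{Tr}\big(\hat U(\theta)^\dagger O\,\hat U(\theta)\rho_x\big)$. Let $\mu$ be a probability distribution on $\mathcal X\times\mathcal Y$, and let $\ell(h,y)$ be a measurable loss that, for each $y\in\mathcal Y$, is $L_1$-Lipschitz in $h$ and satisfies $|\ell(h,y)|\le C_1$ for $h\in[-\|O\|,\|O\|]$. Put $\mathcal R(\theta)=\mathbb E_{(x,y)\sim\mu}\,\ell(h_\theta(x),y)$ and, for a sample $S=((x_i,y_i))_{i=1}^n$, $\hat{\mathcal R}_S(\theta)=\frac1n\sum_{i=1}^n\ell(h_\theta(x_i),y_i)$.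 Then for every $\delta\in(0,1)$, with probability at least $1-\delta$ over $S\sim\mu^{n}$, every learning algorithm $\mathcal A$ that maps samples to parameters in $\Theta$ satisfies $$\mathcal R(\mathcal A(S))-\hat{\mathcal R}_S(\mathcal A(S))\;\le\;\frac{8L_1}{\sqrt n}+\frac{24L_1}{\sqrt n}\,d^{k}\sqrt{N_{gt}}\;\max(1,\|O\|)\Big(\ln^{+}\!\big(7\sqrt n\,N_{gt}\|O\|\big)+1\Big)+3C_1\sqrt{\frac{\ln(1/\delta)}{2n}},$$ where $\ln^+ t=\max(0,\ln t)$ for $t>0$ and $\ln^+0=0$. In particular, for bounded $\|O\|$ and fixed $\delta$ the gap is $\tilde{\mathcal O}\Big(\frac{8L_1+C_1+24L_1d^k\sqrt{N_{gt}}}{\sqrt n}\Big)$, with a hidden factor that is logarithmic in $nN_{gt}$. -/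

import Mathlib

open MeasureTheory
open scoped ComplexOrder

noncomputable section

namespace QNN

/-- Computational basis labels of `N` qudits of local dimension `d`; the Hilbert space
`(ℂ^d)^{⊗N}` is `ℂ^(Basis d N)`, of dimension `d ^ N`. -/
abbrev Basis (d N : ℕ) : Type := Fin N → Fin d

/-- Operators on `N` qudits, i.e. complex `d^N × d^N` matrices. -/
abbrev Operator (d N : ℕ) : Type := Matrix (Basis d N) (Basis d N) ℂ

/-- Unitary operators on the qudits listed in `s`, i.e. the group `U(d ^ |s|)`. -/
abbrev GateOn (d : ℕ) {N : ℕ} (s : Finset (Fin N)) : Type :=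
  Matrix.unitaryGroup ({i // i ∈ s} → Fin d) ℂ

/-- The operator `u ⊗ 1` on `N` qudits, where `u` acts on the qudits in `s` and the identity
on all other qudits. -/
def localOp {d N : ℕ} (s : Finset (Fin N))
    (u : Matrix ({i // i ∈ s} → Fin d) ({i // i ∈ s} → Fin d) ℂ) : Operator d N :=
  Matrix.of fun a b => if ∀ i, i ∉ s → a i = b i then u (fun i => a i.1) (fun i => b i.1) else 0

/-- A parametrized circuit on `N` qudits with `Ng` gates, each acting on at most `k` qudits.
The gates outside `trainable` are fixed: they do not depend on the parameter. -/
structure Ansatz (d N k Ng : ℕ) (Θ : Type*) where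
  /-- the qudits on which the `l`-th gate acts -/
  support : Fin Ng → Finset (Fin N)
  card_support_le : ∀ l, (support l).card ≤ k
  /-- the `l`-th gate `u_l(θ)` -/
  gate : (l : Fin Ng) → Θ → GateOn d (support l)
  /-- the trainable gates -/
  trainable : Finset (Fin Ng)
  fixed : ∀ l, l ∉ trainable → ∀ θ θ' : Θ, gate l θ = gate l θ'

/-- The number of trainable gates. -/
def Ansatz.numTrainable {d N k Ng : ℕ} {Θ : Type*} (c : Ansatz d N k Ng Θ) : ℕ :=
  c.trainable.card

/-- The circuit `U(θ) = u_1(θ) u_2(θ) ⋯ u_{Ng}(θ)`. -/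
def Ansatz.circuit {d N k Ng : ℕ} {Θ : Type*} (c : Ansatz d N k Ng Θ) (θ : Θ) : Operator d N :=
  (List.ofFn fun l => localOp (c.support l) (c.gate l θ).1).prod

/-- Operator norm on the Euclidean space `ℂ^(d^N)`. -/
def opNorm {d N : ℕ} (O : Operator d N) : ℝ :=
  ‖Matrix.toEuclideanCLM (n := Basis d N) (𝕜 := ℂ) O‖

/-- Density operators (quantum states). -/
def IsState {d N : ℕ} (ρ : Operator d N) : Prop :=
  ρ.PosSemidef ∧ ρ.trace = 1

/-- The hypothesis `h_θ(x) = Tr(U(θ)† O U(θ) ρ_x)`. For Hermitian `O` and `ρ_x` the trace is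
a real number, so taking the real part only changes its type. -/
def hypothesis {d N k Ng : ℕ} {Θ X : Type*} (c : Ansatz d N k Ng Θ) (O : Operator d N)
    (ρ : X → Operator d N) (θ : Θ) (x : X) : ℝ :=
  (((c.circuit θ).conjTranspose * O * c.circuit θ * ρ x).trace).re

/-- The expected risk `E_{(x,y) ∼ μ} ℓ(h(x), y)`. -/
def expectedRisk {X Y : Type*} [MeasurableSpace X] [MeasurableSpace Y] (μ : Measure (X × Y))
    (loss : ℝ → Y → ℝ) (h : X → ℝ) : ℝ :=
  ∫ z, loss (h z.1) z.2 ∂μ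

/-- The empirical risk `(1/n) ∑ i, ℓ(h(x_i), y_i)`. -/
def empiricalRisk {X Y : Type*} {n : ℕ} (S : Fin n → X × Y)
    (loss : ℝ → Y → ℝ) (h : X → ℝ) : ℝ :=
  (1 / (n : ℝ)) * ∑ i, loss (h (S i).1) (S i).2

end QNN

end

/-!
Moving each of the `g` trainable gates by at most `2 / t` moves every hypothesis by at most
`4 g ‖O‖ / t`, and by comparison of volumes the trainable gates have such a net of entropy at most
`2 g d^(2k) log (1 + t)`. The choice `t = max (√n g ‖O‖) 1` brings this
distance down to `4 / √n`.

Over the net, the gap of a loss profile `f θ` is split into the gap of the common profile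
`f₀ (x, y) = loss 0 y` and the gap of `f θ - f₀`. They are sub-Gaussian with variance proxies
`C₁² / n` and `(L₁ ‖O‖)² / n`. Since the first does not depend on `θ`, the entropy of the net
is charged to the second only, so that `C₁` multiplies only the confidence term.
-/

namespace QNN

open ProbabilityTheory Real

section MaximalInequality

variable {Ω ι : Type*} [MeasurableSpace Ω] {P : Measure Ω}

-- Convexity of `exp` separates `U` from the `V i`, so that only the latter are summed over `F`.
theorem measureReal_exists_le_weighted_add_le [IsFiniteMeasure P] {F : Finset ι} {U : Ω → ℝ}
    {V : ι → Ω → ℝ} (hU : Integrable (fun ω => exp (U ω)) P)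
    (hV : ∀ i ∈ F, Integrable (fun ω => exp (V i ω)) P) (hU_le : ∫ ω, exp (U ω) ∂P ≤ 1)
    (hV_le : ∑ i ∈ F, ∫ ω, exp (V i ω) ∂P ≤ 1) {α β : ℝ} (hα : 0 ≤ α) (hβ : 0 ≤ β)
    (hαβ : α + β = 1) (r : ℝ) :
    P.real {ω | ∃ i ∈ F, r ≤ α * U ω + β * V i ω} ≤ exp (-r) := by
  let Φ ω := α * exp (U ω) + β * ∑ i ∈ F, exp (V i ω)
  have hUα := hU.const_mul α
  have hVβ := (integrable_finsetSum F hV).const_mul β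
  have hΦ_nonneg (ω) : 0 ≤ Φ ω := by
    simp only [Φ]
    positivity
  have hΦ_le : ∫ ω, Φ ω ∂P ≤ 1 := by
    rw [integral_add hUα hVβ, integral_const_mul, integral_const_mul, integral_finsetSum F hV]
    nlinarith
  have hsub : {ω | ∃ i ∈ F, r ≤ α * U ω + β * V i ω} ⊆ {ω | exp r ≤ Φ ω} := by
    rintro ω ⟨i, hi, hr⟩
    calc exp r ≤ exp (α * U ω + β * V i ω) := exp_le_exp.2 hr
      _ ≤ α * exp (U ω) + β * exp (V i ω) := convexOn_exp.2 trivial trivial hα hβ hαβ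
      _ ≤ Φ ω := by
        have := Finset.single_le_sum (fun j _ => (exp_pos (V j ω)).le) hi
        exact add_le_add_right (mul_le_mul_of_nonneg_left this hβ) _
  have hmarkov : exp r * P.real {ω | exp r ≤ Φ ω} ≤ 1 :=
    (mul_meas_ge_le_integral_of_nonneg (.of_forall hΦ_nonneg) (hUα.add hVβ) _).trans hΦ_le
  rw [Real.exp_neg, ← one_div, le_div_iff₀' (exp_pos r)]
  exact (mul_le_mul_of_nonneg_left (measureReal_mono hsub) (exp_pos r).le).trans hmarkov

variable {c c₀ c₁ : NNReal}

theorem integrable_exp_mul_sub {X : Ω → ℝ} (hX : HasSubgaussianMGF X c P) (t a : ℝ) :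
    Integrable (fun ω => exp (t * X ω - a)) P := by
  simpa only [Real.exp_sub] using (hX.integrable_exp_mul t).div_const (exp a)

theorem integral_exp_mul_sub_le {X : Ω → ℝ} (hX : HasSubgaussianMGF X c P) (t a : ℝ) :
    ∫ ω, exp (t * X ω - a) ∂P ≤ exp (c * t ^ 2 / 2 - a) := by
  simp only [Real.exp_sub, integral_div]
  gcongr
  exact hX.mgf_le t

theorem measureReal_exists_le_add_le [IsFiniteMeasure P] {F : Finset ι} {G : Ω → ℝ}
    {Z : ι → Ω → ℝ} (hG : HasSubgaussianMGF G c₀ P) (hZ : ∀ i ∈ F, HasSubgaussianMGF (Z i) c₁ P)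
    {α β K t : ℝ} (hα : 0 < α) (hβ : 0 < β) (hαβ : α + β = 1) (hK : F.card ≤ exp K) (ht : 0 ≤ t)
    (s : ℝ) :
    P.real {ω | ∃ i ∈ F, s ≤ G ω + Z i ω} ≤
      exp (-(t * s - (c₀ / α + c₁ / β) * t ^ 2 / 2 - β * K)) := by
  set a := c₀ * (t / α) ^ 2 / 2 with ha
  set b := c₁ * (t / β) ^ 2 / 2 + K with hb
  have hG_le : ∫ ω, exp (t / α * G ω - a) ∂P ≤ 1 := by
    simpa [ha] using integral_exp_mul_sub_le hG (t / α) a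
  have hZ_le : ∑ i ∈ F, ∫ ω, exp (t / β * Z i ω - b) ∂P ≤ 1 := calc
    _ ≤ F.card • exp (-K) := Finset.sum_le_card_nsmul _ _ _ fun i hi => by
      simpa [hb] using integral_exp_mul_sub_le (hZ i hi) (t / β) b
    _ ≤ exp K * exp (-K) := by rw [nsmul_eq_mul]; gcongr
    _ = 1 := by rw [← Real.exp_add, add_neg_cancel, Real.exp_zero]
  refine (measureReal_mono ?_).trans <| measureReal_exists_le_weighted_add_le
    (integrable_exp_mul_sub hG _ _) (fun i hi => integrable_exp_mul_sub (hZ i hi) _ _)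
    hG_le hZ_le hα.le hβ.le hαβ _
  rintro ω ⟨i, hi, hs⟩
  refine ⟨i, hi, ?_⟩
  have hsplit : α * (t / α * G ω - a) + β * (t / β * Z i ω - b) =
      t * (G ω + Z i ω) - (c₀ / α + c₁ / β) * t ^ 2 / 2 - β * K := by
    rw [ha, hb]
    field_simp
    ring
  rw [hsplit]
  gcongr

-- The weights `α ∝ c₀`, `β ∝ c₁` and `t = s / (2 (c₀ + c₁))` balance the exponent.
theorem measureReal_exists_le_add_le_of_le_sq [IsFiniteMeasure P] {F : Finset ι}
    {G : Ω → ℝ} {Z : ι → Ω → ℝ} (hG : HasSubgaussianMGF G c₀ P)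
    (hZ : ∀ i ∈ F, HasSubgaussianMGF (Z i) c₁ P) (hc₀ : 0 < c₀) (hc₁ : 0 < c₁) {K L s : ℝ}
    (hK : F.card ≤ exp K) (hs : 0 ≤ s) (hsq : 4 * (c₀ + c₁) * L + 4 * c₁ * K ≤ s ^ 2) :
    P.real {ω | ∃ i ∈ F, s ≤ G ω + Z i ω} ≤ exp (-L) := by
  refine (measureReal_exists_le_add_le hG hZ (α := c₀ / (c₀ + c₁)) (β := c₁ / (c₀ + c₁))
    (t := s / (2 * (c₀ + c₁))) (by positivity) (by positivity) (by field_simp) hK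
    (by positivity) s).trans (exp_le_exp.2 (neg_le_neg ?_))
  have hexp : s / (2 * (c₀ + c₁)) * s -
      (c₀ / (c₀ / (c₀ + c₁)) + c₁ / (c₁ / (c₀ + c₁))) * (s / (2 * (c₀ + c₁))) ^ 2 / 2 -
        c₁ / (c₀ + c₁) * K = (s ^ 2 - 4 * c₁ * K) / (4 * (c₀ + c₁)) := by
    field_simp
    ring
  rw [hexp, le_div_iff₀ (by positivity)]
  linarith

theorem measureReal_exists_le_le_of_le_sq {F : Finset ι} {X : ι → Ω → ℝ}
    (hX : ∀ i ∈ F, HasSubgaussianMGF (X i) c P) (hc : 0 < c) {K L s : ℝ}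
    (hK : F.card ≤ exp K) (hs : 0 ≤ s) (hsq : 2 * c * (K + L) ≤ s ^ 2) :
    P.real {ω | ∃ i ∈ F, s ≤ X i ω} ≤ exp (-L) := by
  have hunion : {ω | ∃ i ∈ F, s ≤ X i ω} = ⋃ i ∈ F, {ω | s ≤ X i ω} := by
    ext
    simp
  have hexponent : -s ^ 2 / (2 * c) ≤ -(K + L) := by
    rw [div_le_iff₀ (by positivity)]
    linarith
  calc P.real {ω | ∃ i ∈ F, s ≤ X i ω}
      ≤ ∑ i ∈ F, P.real {ω | s ≤ X i ω} := hunion ▸ measureReal_biUnion_finset_le _ _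
    _ ≤ F.card • exp (-(K + L)) := Finset.sum_le_card_nsmul _ _ _ fun i hi =>
      ((hX i hi).measure_ge_le hs).trans (exp_le_exp.2 hexponent)
    _ ≤ exp K * exp (-(K + L)) := by rw [nsmul_eq_mul]; gcongr
    _ = exp (-L) := by rw [← Real.exp_add]; congr 1; ring

theorem measureReal_exists_sqrt_add_sqrt_le_add_le [IsFiniteMeasure P] {F : Finset ι}
    {G : Ω → ℝ} {Z : ι → Ω → ℝ} (hG : HasSubgaussianMGF G c₀ P)
    (hZ : ∀ i ∈ F, HasSubgaussianMGF (Z i) c₁ P)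
    (hGZ : ∀ i ∈ F, HasSubgaussianMGF (fun ω => G ω + Z i ω) c₀ P) (hc₀ : 0 < c₀) (hc₁ : 0 < c₁)
    {K L : ℝ} (hK : F.card ≤ exp K) (hK₀ : 0 ≤ K) (hL₀ : 0 ≤ L) :
    P.real {ω | ∃ i ∈ F, 4 * √(c₁ * K) + 3 * √(c₀ * L / 2) ≤ G ω + Z i ω} ≤ exp (-L) := by
  have hsq : 16 * (c₁ * K) + 9 / 2 * (c₀ * L) ≤ (4 * √(c₁ * K) + 3 * √(c₀ * L / 2)) ^ 2 := by
    have h₁ := sq_sqrt (show 0 ≤ c₁ * K by positivity)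
    have h₀ := sq_sqrt (show 0 ≤ c₀ * L / 2 by positivity)
    have : 0 ≤ √(c₁ * K) * √(c₀ * L / 2) := by positivity
    linear_combination 24 * this - 16 * h₁ - 9 * h₀
  have hKc : 0 ≤ c₁ * K := by positivity
  rcases le_total (8 * c₁) c₀ with hc | hc
  · have hcL : 8 * c₁ * L ≤ c₀ * L := by gcongr; exact_mod_cast hc
    exact measureReal_exists_le_add_le_of_le_sq hG hZ hc₀ hc₁ hK (by positivity)
      (by linarith)
  · have hcK : c₀ * K ≤ 8 * c₁ * K := by gcongr; exact_mod_cast hc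
    have hcL : 0 ≤ c₀ * L := by positivity
    exact measureReal_exists_le_le_of_le_sq hGZ hc₀ hK (by positivity) (by linarith)

end MaximalInequality

section GeneralizationGap

variable {Z : Type*} [MeasurableSpace Z] {n : ℕ}

/-- The generalization gap `E f - (1/n) ∑ i, f (S i)` of a loss profile `f` on the sample `S`: the
expected minus the empirical risk of a hypothesis whose loss on the data point `z` is `f z`. -/
noncomputable def generalizationGap (μ : Measure Z) (S : Fin n → Z) (f : Z → ℝ) : ℝ :=
  ∫ z, f z ∂μ - (1 / (n : ℝ)) * ∑ i, f (S i)

variable {μ : Measure Z} {f g : Z → ℝ}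

theorem generalizationGap_sub (hf : Integrable f μ) (hg : Integrable g μ) (S : Fin n → Z) :
    generalizationGap μ S (f - g) = generalizationGap μ S f - generalizationGap μ S g := by
  simp only [generalizationGap, Pi.sub_apply, integral_sub hf hg, Finset.sum_sub_distrib]
  ring

theorem measurable_generalizationGap (μ : Measure Z) (hf : Measurable f) :
    Measurable fun S : Fin n → Z => generalizationGap μ S f := by
  unfold generalizationGap
  fun_prop

variable [IsProbabilityMeasure μ]

theorem abs_generalizationGap_le {κ : ℝ} (hf : ∀ z, |f z| ≤ κ) (S : Fin n → Z) :
    |generalizationGap μ S f| ≤ 2 * κ := by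
  have : Nonempty Z := nonempty_of_isProbabilityMeasure μ
  have hκ : 0 ≤ κ := (abs_nonneg _).trans (hf (Classical.arbitrary Z))
  have hexpected : |∫ z, f z ∂μ| ≤ κ := by
    simpa using norm_integral_le_of_norm_le_const (μ := μ) (f := f) (.of_forall hf)
  have hempirical : |(1 / (n : ℝ)) * ∑ i, f (S i)| ≤ κ := calc
    _ ≤ (1 / (n : ℝ)) * ∑ _i : Fin n, κ := by
      rw [abs_mul, abs_of_nonneg (by positivity)]
      gcongr
      exact (Finset.abs_sum_le_sum_abs _ _).trans (Finset.sum_le_sum fun i _ => hf (S i))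
    _ = (n / n : ℝ) * κ := by
      simp only [Finset.sum_const, Finset.card_univ, Fintype.card_fin, nsmul_eq_mul]
      ring
    _ ≤ κ := mul_le_of_le_one_left hκ (div_self_le_one _)
  rw [two_mul]
  exact (abs_sub _ _).trans (add_le_add hexpected hempirical)

theorem hasSubgaussianMGF_generalizationGap (hn : 1 ≤ n) (hf : Measurable f) {B : NNReal}
    (hB : ∀ z, |f z| ≤ B) :
    HasSubgaussianMGF (fun S : Fin n → Z => generalizationGap μ S f) (B ^ 2 / n)
      (Measure.pi fun _ : Fin n => μ) := by
  have hn₀ : (n : ℝ) ≠ 0 := by positivity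
  have hcentred : HasSubgaussianMGF (fun z => f z - ∫ z, f z ∂μ) (B ^ 2) μ := by
    have hradius : ‖(B : ℝ) - -B‖₊ / 2 = B := by
      ext
      simp [← two_mul]
    exact hradius ▸ hasSubgaussianMGF_of_mem_Icc hf.aemeasurable
      (.of_forall fun z => abs_le.mp (hB z))
  have hcoord (i : Fin n) : HasSubgaussianMGF (fun S : Fin n → Z => f (S i) - ∫ z, f z ∂μ) (B ^ 2)
      (Measure.pi fun _ : Fin n => μ) := by
    have hmp := measurePreserving_eval (fun _ : Fin n => μ) i
    exact .of_map (Y := Function.eval i) (X := fun z => f z - ∫ z, f z ∂μ)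
      hmp.measurable.aemeasurable (by rwa [hmp.map_eq])
  have hindep : iIndepFun (fun (i : Fin n) (S : Fin n → Z) => f (S i) - ∫ z, f z ∂μ)
      (Measure.pi fun _ : Fin n => μ) :=
    iIndepFun_pi fun _ => (hf.sub_const _).aemeasurable
  have hmean := (HasSubgaussianMGF.sum_of_iIndepFun hindep (s := Finset.univ)
    fun i _ => hcoord i).const_mul (-(1 / (n : ℝ)))
  convert hmean using 1
  · funext S
    simp only [generalizationGap, Finset.sum_sub_distrib, Finset.sum_const, Finset.card_univ,
      Fintype.card_fin, nsmul_eq_mul]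
    field_simp
    ring
  · ext
    change _ = (-(1 / (n : ℝ))) ^ 2 * ((∑ _i : Fin n, B ^ 2 : NNReal) : ℝ)
    simp only [NNReal.coe_div, NNReal.coe_pow, NNReal.coe_natCast, NNReal.coe_mul,
      Finset.sum_const, Finset.card_univ, Fintype.card_fin, nsmul_eq_mul]
    field_simp

variable {Θ : Type*} {f : Θ → Z → ℝ} {f₀ : Z → ℝ} {C b : NNReal} {K L κ : ℝ} {F : Finset Θ}

theorem measureReal_exists_le_generalizationGap_le (hn : 1 ≤ n) (hf : ∀ θ, Measurable (f θ))
    (hf_le : ∀ θ z, |f θ z| ≤ C) (hf₀ : Measurable f₀) (hf₀_le : ∀ z, |f₀ z| ≤ C)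
    (hsub_le : ∀ θ z, |f θ z - f₀ z| ≤ b) (hC : 0 < C) (hb : 0 < b)
    (hF : F.card ≤ exp K) (hK : 0 ≤ K) (hL : 0 ≤ L) :
    (Measure.pi fun _ : Fin n => μ).real
      {S | ∃ θ ∈ F, 4 * b * √(K / n) + 3 * C * √(L / (2 * n)) ≤ generalizationGap μ S (f θ)} ≤
        exp (-L) := by
  have hsplit (θ) (S : Fin n → Z) : generalizationGap μ S f₀ +
      generalizationGap μ S (f θ - f₀) = generalizationGap μ S (f θ) := by
    rw [generalizationGap_sub
      (.of_bound (hf θ).aestronglyMeasurable C (.of_forall (hf_le θ)))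
      (.of_bound hf₀.aestronglyMeasurable C (.of_forall hf₀_le))]
    ring
  have hsqrt (B : NNReal) (x : ℝ) : √(B ^ 2 / n * x) = B * √(x / n) := by
    rw [div_mul_eq_mul_div, mul_div_assoc, sqrt_mul (by positivity), sqrt_sq B.coe_nonneg]
  have htail := measureReal_exists_sqrt_add_sqrt_le_add_le (P := Measure.pi fun _ : Fin n => μ)
    (hasSubgaussianMGF_generalizationGap hn hf₀ hf₀_le)
    (fun θ _ => hasSubgaussianMGF_generalizationGap (μ := μ) hn ((hf θ).sub hf₀) (hsub_le θ))
    (fun θ _ => by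
      simpa only [hsplit] using hasSubgaussianMGF_generalizationGap hn (hf θ) (hf_le θ))
    (by positivity) (by positivity) hF hK hL
  have hC_eq : √(C ^ 2 / n * L / 2) = C * √(L / (2 * n)) := by
    rw [mul_div_assoc, hsqrt, div_div]
  push_cast at htail
  simpa only [hsplit, hsqrt, hC_eq, ← mul_assoc] using htail

theorem exists_measurableSet_generalizationGap_le_of_pos (hn : 1 ≤ n)
    (hf : ∀ θ, Measurable (f θ)) (hf_le : ∀ θ z, |f θ z| ≤ C) (hf₀ : Measurable f₀)
    (hf₀_le : ∀ z, |f₀ z| ≤ C) (hsub_le : ∀ θ z, |f θ z - f₀ z| ≤ b) (hC : 0 < C) (hb : 0 < b)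
    (hF : F.card ≤ exp K) (hK : 0 ≤ K) (hnet : ∀ θ, ∃ θ' ∈ F, ∀ z, |f θ z - f θ' z| ≤ κ)
    {δ : ℝ} (hδ0 : 0 < δ) (hδ1 : δ ≤ 1) :
    ∃ E : Set (Fin n → Z), MeasurableSet E ∧
      ENNReal.ofReal (1 - δ) ≤ (Measure.pi fun _ : Fin n => μ) E ∧ ∀ S ∈ E, ∀ θ,
        generalizationGap μ S (f θ) ≤
          2 * κ + 4 * b * √(K / n) + 3 * C * √(log (1 / δ) / (2 * n)) := by
  set s := 4 * b * √(K / n) + 3 * C * √(log (1 / δ) / (2 * n)) with hs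
  have hint (θ) : Integrable (f θ) μ :=
    .of_bound (hf θ).aestronglyMeasurable C (.of_forall (hf_le θ))
  have hmeas : MeasurableSet {S : Fin n → Z | ∃ θ ∈ F, s ≤ generalizationGap μ S (f θ)} := by
    simp only [← exists_prop, Set.ofPred_exists]
    exact F.measurableSet_biUnion fun θ _ =>
      measurableSet_le measurable_const (measurable_generalizationGap μ (hf θ))
  have htail := measureReal_exists_le_generalizationGap_le (μ := μ) (K := K) hn hf hf_le hf₀
    hf₀_le hsub_le hC hb hF hK (log_nonneg ((one_le_div hδ0).2 hδ1))
  rw [one_div, log_inv, neg_neg, exp_log hδ0, ← log_inv, ← one_div, ← hs] at htail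
  refine ⟨_, hmeas.compl, ?_, fun S hS θ => ?_⟩
  · rw [← ofReal_measureReal, probReal_compl_eq_one_sub hmeas]
    gcongr
  · obtain ⟨θ', hθ', hclose⟩ := hnet θ
    have hnet_gap : generalizationGap μ S (f θ') < s := by
      by_contra! h
      exact hS ⟨θ', hθ', h⟩
    have hdiff := (abs_le.mp (abs_generalizationGap_le (μ := μ) (f := f θ - f θ') hclose S)).2
    rw [generalizationGap_sub (hint θ) (hint θ')] at hdiff
    linarith

theorem exists_measurableSet_generalizationGap_le (hn : 1 ≤ n)
    (hf : ∀ θ, Measurable (f θ)) (hf_le : ∀ θ z, |f θ z| ≤ C) (hf₀ : Measurable f₀)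
    (hf₀_le : ∀ z, |f₀ z| ≤ C) (hsub_le : ∀ θ z, |f θ z - f₀ z| ≤ b)
    (hF : F.card ≤ exp K) (hK : 0 ≤ K) (hnet : ∀ θ, ∃ θ' ∈ F, ∀ z, |f θ z - f θ' z| ≤ κ)
    {δ : ℝ} (hδ0 : 0 < δ) (hδ1 : δ ≤ 1) :
    ∃ E : Set (Fin n → Z), MeasurableSet E ∧
      ENNReal.ofReal (1 - δ) ≤ (Measure.pi fun _ : Fin n => μ) E ∧ ∀ S ∈ E, ∀ θ,
        generalizationGap μ S (f θ) ≤
          2 * κ + 4 * b * √(K / n) + 3 * C * √(log (1 / δ) / (2 * n)) := by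
  have : Nonempty Z := nonempty_of_isProbabilityMeasure μ
  rcases isEmpty_or_nonempty Θ with hΘ | ⟨⟨θ₀⟩⟩
  · exact ⟨Set.univ, .univ, by simpa using hδ0.le, fun _ _ θ => hΘ.elim θ⟩
  have hκ : 0 ≤ κ := by
    obtain ⟨θ', -, h⟩ := hnet θ₀
    exact (abs_nonneg _).trans (h (Classical.arbitrary Z))
  rcases eq_zero_or_pos C with rfl | hC
  · have hzero (θ) : f θ = 0 := funext fun z => by simpa using hf_le θ z
    refine ⟨Set.univ, .univ, by simpa using hδ0.le, fun S _ θ => ?_⟩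
    simp only [hzero, generalizationGap, Pi.zero_apply, integral_zero, Finset.sum_const_zero,
      mul_zero, sub_zero]
    positivity
  rcases eq_zero_or_pos b with rfl | hb
  · have hconst (θ) : f θ = f₀ := funext fun z => by simpa [sub_eq_zero] using hsub_le θ z
    simpa using exists_measurableSet_generalizationGap_le_of_pos (F := {θ₀}) (b := 1) (K := 0)
      (κ := κ) hn hf hf_le hf₀ hf₀_le (fun θ z => by simp [hconst]) hC one_pos (by simp) le_rfl
      (fun θ => ⟨θ₀, by simp, fun z => by simpa [hconst] using hκ⟩) hδ0 hδ1
  exact exists_measurableSet_generalizationGap_le_of_pos hn hf hf_le hf₀ hf₀_le hsub_le hC hb hF hK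
    hnet hδ0 hδ1

end GeneralizationGap

section CoveringNumbers

open Metric Module
open scoped NNReal

variable {E : Type*} [NormedAddCommGroup E] [NormedSpace ℝ E] [FiniteDimensional ℝ E]

theorem card_le_of_isSeparated {C : Finset E} {x : E} {r ε : ℝ≥0} (hε : 0 < ε)
    (hsep : IsSeparated ε (C : Set E)) (hC : (C : Set E) ⊆ closedBall x r) :
    C.card ≤ (1 + 2 * r / ε : ℝ) ^ finrank ℝ E := by
  borelize E
  let μ : Measure E := Measure.addHaar
  have hε₂ : (0 : ℝ) < ε / 2 := by positivity
  have hR : (0 : ℝ) < r + ε / 2 := by positivity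
  have hdisj : (C : Set E).PairwiseDisjoint fun y => ball y (ε / 2) := fun y hy z hz hyz => by
    have hdist : (ε : ℝ) < dist y z :=
      lt_of_not_ge fun h => (hsep hy hz hyz).not_ge (edist_le_coe.2 h)
    exact ball_disjoint_ball (by linarith)
  have hsub : (⋃ y ∈ C, ball y (ε / 2 : ℝ)) ⊆ ball x (r + ε / 2) :=
    Set.iUnion₂_subset fun y hy => ball_subset_ball' (by linarith [mem_closedBall.1 (hC hy)])
  have hvol : C.card * (ε / 2 : ℝ) ^ finrank ℝ E * μ.real (ball 0 1) ≤
      (r + ε / 2 : ℝ) ^ finrank ℝ E * μ.real (ball 0 1) := calc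
    _ = μ.real (⋃ y ∈ C, ball y (ε / 2 : ℝ)) := by
      rw [measureReal_biUnion_finset hdisj fun _ _ => measurableSet_ball]
      simp [measureReal_def, μ.addHaar_ball_of_pos _ hε₂, mul_assoc, hε₂.le]
    _ ≤ μ.real (ball x (r + ε / 2)) := measureReal_mono hsub measure_ball_lt_top.ne
    _ = _ := by simp [measureReal_def, μ.addHaar_ball_of_pos _ hR, hR.le]
  have hunit : 0 < μ.real (ball 0 1) :=
    ENNReal.toReal_pos (measure_ball_pos μ 0 one_pos).ne' measure_ball_lt_top.ne
  have hratio : (1 + 2 * r / ε : ℝ) = (r + ε / 2) / (ε / 2) := by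
    field_simp
    ring
  rw [hratio, div_pow, le_div_iff₀ (by positivity)]
  exact le_of_mul_le_mul_right hvol hunit

theorem coveringNumber_le_of_subset_closedBall {A : Set E} {x : E} {r ε : ℝ≥0} (hε : 0 < ε)
    (hA : A ⊆ closedBall x r) :
    coveringNumber ε A ≤ ⌊(1 + 2 * r / ε : ℝ) ^ finrank ℝ E⌋₊ := by
  refine (coveringNumber_le_packingNumber ε A).trans (iSup₂_le fun C hCA => iSup_le fun hC => ?_)
  by_contra! hlarge
  obtain ⟨T, hTC, hT⟩ := Set.exists_subset_encard_eq (Order.add_one_le_of_lt hlarge)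
  lift T to Finset E using Set.finite_of_encard_eq_coe (k := _ + 1) hT
  rw [Set.encard_coe_eq_coe_finsetCard] at hT
  have := Nat.le_floor (card_le_of_isSeparated hε (hC.subset hTC) (hTC.trans (hCA.trans hA)))
  have hT' : T.card = _ + 1 := Nat.cast_injective (R := ℕ∞) hT
  omega

theorem exists_finset_forall_norm_sub_le {ι : Type*} {f : ι → E} {r ε : ℝ≥0} (hε : 0 < ε)
    (hf : ∀ i, ‖f i‖ ≤ r) :
    ∃ F : Finset ι, F.card ≤ (1 + 2 * r / ε : ℝ) ^ finrank ℝ E ∧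
      ∀ i, ∃ j ∈ F, ‖f i - f j‖ ≤ ε := by
  have hnumber := coveringNumber_le_of_subset_closedBall (A := Set.range f) (x := 0) hε
    (by rintro _ ⟨i, rfl⟩; simpa using hf i)
  obtain ⟨N, hNf, hNfin, hcover, hNcard⟩ :=
    exists_set_encard_eq_coveringNumber (hnumber.trans_lt (ENat.natCast_lt_top _)).ne
  obtain ⟨F, rfl, hinj⟩ := Set.exists_image_eq_injOn_of_subset_range hNf
  lift F to Finset ι using Set.Finite.of_finite_image hNfin hinj
  rw [hinj.encard_image, Set.encard_coe_eq_coe_finsetCard] at hNcard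
  refine ⟨F, (Nat.le_floor_iff (by positivity)).1 (by exact_mod_cast hNcard.trans_le hnumber),
    fun i => ?_⟩
  obtain ⟨_, ⟨j, hj, rfl⟩, hij⟩ := hcover ⟨i, rfl⟩
  refine ⟨j, hj, ?_⟩
  rw [← dist_eq_norm]
  exact edist_le_coe.1 hij

end CoveringNumbers

section UnitaryProducts

variable {R : Type*} [NormedRing R] [StarRing R] [CStarRing R]

theorem norm_le_one_of_mem_unitary {u : R} (hu : u ∈ unitary R) : ‖u‖ ≤ 1 := by
  rcases subsingleton_or_nontrivial R with _ | _
  · simp [Subsingleton.elim u 0]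
  · exact (CStarRing.norm_of_mem_unitary hu).le

theorem norm_list_prod_sub_le {m : ℕ} {a b : Fin m → R} (ha : ∀ i, a i ∈ unitary R)
    (hb : ∀ i, b i ∈ unitary R) :
    ‖(List.ofFn a).prod - (List.ofFn b).prod‖ ≤ ∑ i, ‖a i - b i‖ := by
  induction m with
  | zero => simp
  | succ m ih =>
    rw [List.ofFn_succ, List.prod_cons, List.ofFn_succ, List.prod_cons, Fin.sum_univ_succ]
    set A := (List.ofFn fun i : Fin m => a i.succ).prod
    set B := (List.ofFn fun i : Fin m => b i.succ).prod
    have hA : A ∈ unitary R := list_prod_mem (by simpa using fun i => ha _)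
    calc ‖a 0 * A - b 0 * B‖ = ‖(a 0 - b 0) * A + b 0 * (A - B)‖ := by noncomm_ring
      _ ≤ ‖(a 0 - b 0) * A‖ + ‖b 0 * (A - B)‖ := norm_add_le _ _
      _ = ‖a 0 - b 0‖ + ‖A - B‖ := by
        rw [CStarRing.norm_mul_mem_unitary _ hA, CStarRing.norm_mem_unitary_mul _ (hb 0)]
      _ ≤ ‖a 0 - b 0‖ + ∑ i : Fin m, ‖a i.succ - b i.succ‖ := by
        gcongr
        exact ih (fun i => ha i.succ) fun i => hb i.succ

theorem norm_star_mul_mul_of_mem_unitary {u : R} (hu : u ∈ unitary R) (x : R) :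
    ‖star u * x * u‖ = ‖x‖ := by
  rw [CStarRing.norm_mul_mem_unitary _ hu,
    CStarRing.norm_mem_unitary_mul _ (Unitary.star_mem hu)]

theorem norm_star_mul_mul_sub_le_of_mem_unitary {u v : R} (hu : u ∈ unitary R)
    (hv : v ∈ unitary R) (x : R) :
    ‖star u * x * u - star v * x * v‖ ≤ 2 * ‖x‖ * ‖u - v‖ := calc
  _ = ‖star (u - v) * x * u + star v * (x * (u - v))‖ := by
    rw [star_sub]
    noncomm_ring
  _ ≤ ‖star (u - v) * x * u‖ + ‖star v * (x * (u - v))‖ := norm_add_le _ _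
  _ = ‖star (u - v) * x‖ + ‖x * (u - v)‖ := by
    rw [CStarRing.norm_mul_mem_unitary _ hu,
      CStarRing.norm_mem_unitary_mul _ (Unitary.star_mem hv)]
  _ ≤ ‖star (u - v)‖ * ‖x‖ + ‖x‖ * ‖u - v‖ := add_le_add (norm_mul_le _ _) (norm_mul_le _ _)
  _ = 2 * ‖x‖ * ‖u - v‖ := by
    rw [norm_star]
    ring

end UnitaryProducts

section Circuits

open scoped Kronecker Matrix Matrix.Norms.L2Operator

section Trace

open scoped MatrixOrder

variable {m : Type*} [Fintype m] [DecidableEq m]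

theorem trace_mul_conjTranspose_mul_self (A B : Matrix m m ℂ) :
    (A * (Bᴴ * B)).trace = ∑ i, inner ℂ (WithLp.toLp 2 (star (B i)))
      (Matrix.toEuclideanCLM (n := m) (𝕜 := ℂ) A (WithLp.toLp 2 (star (B i)))) := by
  rw [← Matrix.mul_assoc, Matrix.trace_mul_comm, ← Matrix.mul_assoc, Matrix.trace]
  refine Finset.sum_congr rfl fun i _ => ?_
  rw [Matrix.toEuclideanCLM_toLp, EuclideanSpace.inner_toLp_toLp, star_star, dotProduct_comm,
    Matrix.diag_apply, Matrix.mul_assoc, Matrix.mul_apply']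
  rfl

theorem norm_trace_mul_le_of_posSemidef (A : Matrix m m ℂ) {ρ : Matrix m m ℂ}
    (hρ : ρ.PosSemidef) : ‖(A * ρ).trace‖ ≤ ‖A‖ * ρ.trace.re := by
  obtain ⟨B, rfl⟩ : ∃ B : Matrix m m ℂ, ρ = Bᴴ * B :=
    CStarAlgebra.nonneg_iff_eq_star_mul_self.mp hρ.nonneg
  set v : m → EuclideanSpace ℂ m := fun i => WithLp.toLp 2 (star (B i))
  have htrace : (Bᴴ * B).trace.re = ∑ i, ‖v i‖ ^ 2 := by
    rw [← one_mul (Bᴴ * B), trace_mul_conjTranspose_mul_self, Complex.re_sum]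
    refine Finset.sum_congr rfl fun i _ => ?_
    rw [map_one]
    exact inner_self_eq_norm_sq (𝕜 := ℂ) (v i)
  rw [htrace, trace_mul_conjTranspose_mul_self, Finset.mul_sum]
  refine norm_sum_le_of_le _ fun i _ => (norm_inner_le_norm _ _).trans ?_
  calc ‖v i‖ * ‖Matrix.toEuclideanCLM (n := m) (𝕜 := ℂ) A (v i)‖ ≤ ‖v i‖ * (‖A‖ * ‖v i‖) := by
        gcongr
        exact ContinuousLinearMap.le_opNorm _ _
    _ = ‖A‖ * ‖v i‖ ^ 2 := by ring

end Trace

section LocalOp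

variable {d N : ℕ} (s : Finset (Fin N))

theorem localOp_eq_submatrix (u : Matrix ({i // i ∈ s} → Fin d) ({i // i ∈ s} → Fin d) ℂ) :
    localOp s u = (u ⊗ₖ (1 : Matrix ({i // i ∉ s} → Fin d) ({i // i ∉ s} → Fin d) ℂ)).submatrix
      (Equiv.piEquivPiSubtypeProd (fun i => i ∈ s) fun _ => Fin d)
      (Equiv.piEquivPiSubtypeProd (fun i => i ∈ s) fun _ => Fin d) := by
  ext a b
  simp [localOp, Matrix.kroneckerMap_apply, Matrix.one_apply, funext_iff]

/-- The embedding `u ↦ u ⊗ 1` of the operators on the qudits in `s` as a homomorphism of star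
algebras; its underlying function is `localOp s`. -/
def localOpHom (d : ℕ) :
    Matrix ({i // i ∈ s} → Fin d) ({i // i ∈ s} → Fin d) ℂ →⋆ₐ[ℂ] Operator d N where
  toFun := localOp s
  map_one' := by rw [localOp_eq_submatrix, Matrix.one_kronecker_one, Matrix.submatrix_one_equiv]
  map_mul' u v := by
    rw [localOp_eq_submatrix, localOp_eq_submatrix, localOp_eq_submatrix,
      Matrix.submatrix_mul_equiv, ← Matrix.mul_kronecker_mul, one_mul]
  map_zero' := by
    rw [localOp_eq_submatrix, Matrix.zero_kronecker, Matrix.submatrix_zero]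
    rfl
  map_add' u v := by
    rw [localOp_eq_submatrix, localOp_eq_submatrix, localOp_eq_submatrix, Matrix.add_kronecker,
      Matrix.submatrix_add]
    rfl
  commutes' r := by
    rw [Algebra.algebraMap_eq_smul_one, Algebra.algebraMap_eq_smul_one, localOp_eq_submatrix,
      Matrix.smul_kronecker, Matrix.one_kronecker_one, Matrix.submatrix_smul]
    simp
  map_star' u := by
    rw [localOp_eq_submatrix, localOp_eq_submatrix, Matrix.star_eq_conjTranspose,
      Matrix.star_eq_conjTranspose, Matrix.conjTranspose_submatrix,
      Matrix.conjTranspose_kronecker, Matrix.conjTranspose_one]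

theorem localOp_mem_unitary (u : GateOn d s) : localOp s u.1 ∈ unitary (Operator d N) :=
  Unitary.map_mem (localOpHom s d) u.2

theorem norm_localOp_sub_le (u v : Matrix ({i // i ∈ s} → Fin d) ({i // i ∈ s} → Fin d) ℂ) :
    ‖localOp s u - localOp s v‖ ≤ ‖u - v‖ := by
  have hsub : localOp s u - localOp s v = localOpHom s d (u - v) :=
    (map_sub (localOpHom s d) u v).symm
  rw [hsub]
  exact NonUnitalStarAlgHom.norm_apply_le (localOpHom s d) (u - v)

end LocalOp

variable {d N k Ng : ℕ} {Θ X : Type*} (c : Ansatz d N k Ng Θ)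

theorem Ansatz.circuit_mem_unitary (θ : Θ) : c.circuit θ ∈ unitary (Operator d N) :=
  list_prod_mem (by simpa using fun l => localOp_mem_unitary (c.support l) (c.gate l θ))

theorem Ansatz.norm_circuit_sub_le {θ θ' : Θ} {ε : ℝ}
    (h : ∀ l ∈ c.trainable, ‖(c.gate l θ).1 - (c.gate l θ').1‖ ≤ ε) :
    ‖c.circuit θ - c.circuit θ'‖ ≤ c.numTrainable * ε := calc
  _ ≤ ∑ l, ‖localOp (c.support l) (c.gate l θ).1 - localOp (c.support l) (c.gate l θ').1‖ :=
    norm_list_prod_sub_le (fun _ => localOp_mem_unitary _ _) fun _ => localOp_mem_unitary _ _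
  _ ≤ ∑ l, ‖(c.gate l θ).1 - (c.gate l θ').1‖ :=
    Finset.sum_le_sum fun _ _ => norm_localOp_sub_le _ _ _
  _ = ∑ l ∈ c.trainable, ‖(c.gate l θ).1 - (c.gate l θ').1‖ :=
    (Finset.sum_subset (Finset.subset_univ _) fun l _ hl => by simp [c.fixed l hl θ θ']).symm
  _ ≤ c.numTrainable * ε := by
    rw [Ansatz.numTrainable, ← nsmul_eq_mul]
    exact Finset.sum_le_card_nsmul _ _ _ h

section Hypothesis

variable (O : Operator d N) {ρ : X → Operator d N}

theorem abs_hypothesis_le (hρ : ∀ x, IsState (ρ x)) (θ : Θ) (x : X) :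
    |hypothesis c O ρ θ x| ≤ opNorm O := calc
  _ ≤ ‖((c.circuit θ)ᴴ * O * c.circuit θ * ρ x).trace‖ := Complex.abs_re_le_norm _
  _ ≤ ‖(c.circuit θ)ᴴ * O * c.circuit θ‖ := by
    simpa [(hρ x).2] using norm_trace_mul_le_of_posSemidef _ (hρ x).1
  _ = opNorm O := norm_star_mul_mul_of_mem_unitary (c.circuit_mem_unitary θ) O

theorem abs_hypothesis_sub_le (hρ : ∀ x, IsState (ρ x)) {θ θ' : Θ} {ε : ℝ}
    (h : ∀ l ∈ c.trainable, ‖(c.gate l θ).1 - (c.gate l θ').1‖ ≤ ε) (x : X) :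
    |hypothesis c O ρ θ x - hypothesis c O ρ θ' x| ≤ 2 * opNorm O * (c.numTrainable * ε) := by
  set U := c.circuit θ
  set V := c.circuit θ'
  calc _ = |(((Uᴴ * O * U - Vᴴ * O * V) * ρ x).trace).re| := by
        rw [sub_mul, Matrix.trace_sub, Complex.sub_re]
        rfl
    _ ≤ ‖((Uᴴ * O * U - Vᴴ * O * V) * ρ x).trace‖ := Complex.abs_re_le_norm _
    _ ≤ ‖Uᴴ * O * U - Vᴴ * O * V‖ := by
      simpa [(hρ x).2] using norm_trace_mul_le_of_posSemidef _ (hρ x).1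
    _ ≤ 2 * opNorm O * ‖U - V‖ := norm_star_mul_mul_sub_le_of_mem_unitary
      (c.circuit_mem_unitary θ) (c.circuit_mem_unitary θ') O
    _ ≤ 2 * opNorm O * (c.numTrainable * ε) := by
      have : 0 ≤ opNorm O := norm_nonneg _
      gcongr
      exact c.norm_circuit_sub_le h

theorem measurable_hypothesis [MeasurableSpace X] (hρ : ∀ a b, Measurable fun x => ρ x a b)
    (θ : Θ) : Measurable (hypothesis c O ρ θ) := by
  unfold hypothesis
  simp only [Matrix.trace, Matrix.diag_apply, Matrix.mul_apply (N := ρ _)]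
  fun_prop

end Hypothesis

section Net

theorem Ansatz.finrank_trainable_le (hd : 1 ≤ d) :
    Module.finrank ℝ (∀ l : c.trainable,
      Matrix ({i // i ∈ c.support l} → Fin d) ({i // i ∈ c.support l} → Fin d) ℂ) ≤
      2 * (c.numTrainable * (d ^ k) ^ 2) := by
  rw [finrank_real_of_complex, Module.finrank_pi_fintype]
  gcongr
  calc ∑ l : c.trainable, Module.finrank ℂ
        (Matrix ({i // i ∈ c.support l} → Fin d) ({i // i ∈ c.support l} → Fin d) ℂ)
      = ∑ l : c.trainable, (d ^ (c.support l).card) ^ 2 := by simp [Module.finrank_matrix, sq]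
    _ ≤ ∑ _l : c.trainable, (d ^ k) ^ 2 := by
      gcongr with l
      exact c.card_support_le l
    _ = c.numTrainable * (d ^ k) ^ 2 := by simp [Ansatz.numTrainable]

theorem Ansatz.exists_finset_forall_norm_gate_sub_le (hd : 1 ≤ d) {ε : NNReal} (hε : 0 < ε) :
    ∃ F : Finset Θ, F.card ≤ (1 + 2 / ε : ℝ) ^ (2 * (c.numTrainable * (d ^ k) ^ 2)) ∧
      ∀ θ, ∃ θ' ∈ F, ∀ l ∈ c.trainable, ‖(c.gate l θ).1 - (c.gate l θ').1‖ ≤ ε := by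
  let f (θ : Θ) (l : c.trainable) := (c.gate l θ).1
  have hf (θ) : ‖f θ‖ ≤ (1 : NNReal) :=
    (pi_norm_le_iff_of_nonneg zero_le_one).2 fun l => norm_le_one_of_mem_unitary (c.gate l θ).2
  obtain ⟨F, hcard, hnet⟩ := exists_finset_forall_norm_sub_le hε hf
  refine ⟨F, hcard.trans ?_, fun θ => ?_⟩
  · rw [NNReal.coe_one, mul_one]
    exact pow_le_pow_right₀ (le_add_of_nonneg_right (by positivity)) (c.finrank_trainable_le hd)
  · obtain ⟨θ', hθ', hclose⟩ := hnet θ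
    exact ⟨θ', hθ', fun l hl => (norm_le_pi_norm (f θ - f θ') ⟨l, hl⟩).trans hclose⟩

theorem Ansatz.exists_finset_forall_abs_hypothesis_sub_le (hd : 1 ≤ d) (O : Operator d N)
    {ρ : X → Operator d N} (hρ : ∀ x, IsState (ρ x)) {t : ℝ} (ht : 0 < t) :
    ∃ F : Finset Θ, F.card ≤ exp (2 * (c.numTrainable * ((d : ℝ) ^ k) ^ 2) * log (1 + t)) ∧
      ∀ θ, ∃ θ' ∈ F, ∀ x, |hypothesis c O ρ θ x - hypothesis c O ρ θ' x| ≤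
        4 * (c.numTrainable * opNorm O) / t := by
  lift t to NNReal using ht.le
  obtain ⟨F, hcard, hnet⟩ := c.exists_finset_forall_norm_gate_sub_le hd (ε := 2 / t)
    (div_pos two_pos ht)
  refine ⟨F, hcard.trans_eq ?_, fun θ => ?_⟩
  · have hradius : (2 / (2 / t : NNReal) : ℝ) = t := by
      push_cast
      exact div_div_cancel₀ two_ne_zero
    rw [hradius, mul_comm _ (log _), exp_mul, exp_log (by positivity), ← rpow_natCast]
    push_cast
    rfl
  · obtain ⟨θ', hθ', hclose⟩ := hnet θ
    refine ⟨θ', hθ', fun x => (abs_hypothesis_sub_le c O hρ hclose x).trans_eq ?_⟩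
    push_cast
    ring

theorem log_one_add_max_one_le (t : ℝ) : log (1 + max t 1) ≤ max 0 (log (7 * t)) + 1 := by
  rcases le_total t 1 with ht | ht
  · rw [max_eq_right ht, one_add_one_eq_two]
    linarith [log_two_lt_d9, le_max_left 0 (log (7 * t))]
  · rw [max_eq_left ht]
    linarith [log_le_log (by linarith) (by linarith : 1 + t ≤ 7 * t),
      le_max_right 0 (log (7 * t))]

theorem sqrt_two_mul_log_one_add_max_one_le {g D : ℝ} (hg : 0 ≤ g) (hD : 0 ≤ D) (t : ℝ) :
    √(2 * (g * D ^ 2) * log (1 + max t 1)) ≤ 6 * (D * √g) * (max 0 (log (7 * t)) + 1) := by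
  set l := max 0 (log (7 * t)) + 1
  have hl : 1 ≤ l := le_add_of_nonneg_left (le_max_left _ _)
  refine sqrt_le_iff.2 ⟨by positivity, ?_⟩
  calc 2 * (g * D ^ 2) * log (1 + max t 1) ≤ 36 * (g * D ^ 2) * l ^ 2 := by
        have hlog := (log_one_add_max_one_le t).trans (le_self_pow₀ hl two_ne_zero)
        have hcoeff : 2 * (g * D ^ 2) ≤ 36 * (g * D ^ 2) := by gcongr; norm_num
        exact mul_le_mul hcoeff hlog (log_nonneg (by simp)) (by positivity)
    _ = (6 * (D * √g) * l) ^ 2 := by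
      rw [mul_pow, mul_pow, mul_pow, sq_sqrt hg]
      ring

end Net

theorem expectedRisk_sub_empiricalRisk {Y : Type*} [MeasurableSpace X] [MeasurableSpace Y]
    (μ : Measure (X × Y)) (loss : ℝ → Y → ℝ) (h : X → ℝ) {n : ℕ} (S : Fin n → X × Y) :
    expectedRisk μ loss h - empiricalRisk S loss h =
      generalizationGap μ S fun z => loss (h z.1) z.2 :=
  rfl

theorem exists_measurableSet_expectedRisk_sub_empiricalRisk_le (hd : 1 ≤ d) {n : ℕ} (hn : 1 ≤ n)
    {Y : Type*} [MeasurableSpace X] [MeasurableSpace Y] (O : Operator d N) {ρ : X → Operator d N}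
    (hρ : ∀ x, IsState (ρ x)) (hρ_meas : ∀ a b, Measurable fun x => ρ x a b)
    (μ : Measure (X × Y)) [IsProbabilityMeasure μ] {loss : ℝ → Y → ℝ}
    (hloss_meas : Measurable (Function.uncurry loss)) {L : NNReal} {C : ℝ}
    (hlip : ∀ y, LipschitzOnWith L (fun t => loss t y) (Set.Icc (-opNorm O) (opNorm O)))
    (hbdd : ∀ y, ∀ t ∈ Set.Icc (-opNorm O) (opNorm O), |loss t y| ≤ C)
    {δ : ℝ} (hδ0 : 0 < δ) (hδ1 : δ ≤ 1) {t : ℝ} (ht : 0 < t) :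
    ∃ E : Set (Fin n → X × Y), MeasurableSet E ∧
      ENNReal.ofReal (1 - δ) ≤ (Measure.pi fun _ : Fin n => μ) E ∧ ∀ S ∈ E, ∀ θ,
        expectedRisk μ loss (hypothesis c O ρ θ) - empiricalRisk S loss (hypothesis c O ρ θ) ≤
          2 * (L * (4 * (c.numTrainable * opNorm O) / t)) +
          4 * (L * opNorm O) *
            √(2 * (c.numTrainable * ((d : ℝ) ^ k) ^ 2) * log (1 + t) / n) +
          3 * C * √(log (1 / δ) / (2 * n)) := by
  have hO : 0 ≤ opNorm O := norm_nonneg _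
  have hzero : (0 : ℝ) ∈ Set.Icc (-opNorm O) (opNorm O) := by simpa using hO
  have hmem (θ x) := abs_le.1 (abs_hypothesis_le c O hρ θ x)
  have hmeas (θ) := measurable_hypothesis c O hρ_meas θ
  have hloss {r s κ : ℝ} (y : Y) (hr : r ∈ Set.Icc (-opNorm O) (opNorm O))
      (hs : s ∈ Set.Icc (-opNorm O) (opNorm O)) (hrs : |r - s| ≤ κ) :
      |loss r y - loss s y| ≤ L * κ :=
    ((hlip y).dist_le_mul r hr s hs).trans (mul_le_mul_of_nonneg_left hrs L.2)
  obtain ⟨-, y₀⟩ := (nonempty_of_isProbabilityMeasure μ).some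
  lift C to NNReal using (abs_nonneg _).trans (hbdd y₀ 0 hzero)
  obtain ⟨F, hF, hnet⟩ := c.exists_finset_forall_abs_hypothesis_sub_le hd O hρ ht
  have hradius : (L * opNorm O : ℝ) = (L * ⟨opNorm O, hO⟩ : NNReal) := rfl
  simp only [expectedRisk_sub_empiricalRisk, hradius]
  exact exists_measurableSet_generalizationGap_le (μ := μ)
    (f := fun θ z => loss (hypothesis c O ρ θ z.1) z.2) (f₀ := fun z => loss 0 z.2)
    (b := L * ⟨opNorm O, hO⟩) hn
    (fun θ => by fun_prop) (fun θ z => hbdd _ _ (hmem θ z.1))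
    (by fun_prop) (fun z => hbdd _ _ hzero)
    (fun θ z => hloss z.2 (hmem θ z.1) hzero (by simpa using abs_hypothesis_le c O hρ θ z.1))
    hF (mul_nonneg (by positivity) (log_nonneg (le_add_of_nonneg_right ht.le)))
    (fun θ => (hnet θ).imp fun θ' h =>
      ⟨h.1, fun z => hloss z.2 (hmem θ z.1) (hmem θ' z.1) (h.2 z.1)⟩)
    hδ0 hδ1

end Circuits

end QNN

open Real in
theorem theorem2_general
    {d N k Ng n : ℕ} (hd : 1 ≤ d) (hn : 1 ≤ n)
    {Θ X Y : Type*} [MeasurableSpace X] [MeasurableSpace Y]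
    (c : QNN.Ansatz d N k Ng Θ) (O : QNN.Operator d N)
    (ρ : X → QNN.Operator d N) (hρ : ∀ x, QNN.IsState (ρ x))
    (hρ_meas : ∀ a b, Measurable fun x => ρ x a b)
    (μ : Measure (X × Y)) [IsProbabilityMeasure μ]
    (loss : ℝ → Y → ℝ) (hloss_meas : Measurable (Function.uncurry loss))
    (L₁ : NNReal) (C₁ : ℝ)
    (hlip : ∀ y, LipschitzOnWith L₁ (fun t => loss t y)
      (Set.Icc (-QNN.opNorm O) (QNN.opNorm O)))
    (hbdd : ∀ y, ∀ t ∈ Set.Icc (-QNN.opNorm O) (QNN.opNorm O), |loss t y| ≤ C₁)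
    (δ : ℝ) (hδ0 : 0 < δ) (hδ1 : δ ≤ 1) :
    ∃ E : Set (Fin n → X × Y), MeasurableSet E ∧
      ENNReal.ofReal (1 - δ) ≤ (Measure.pi fun _ : Fin n => μ) E ∧
      ∀ S ∈ E, ∀ θ : Θ,
        QNN.expectedRisk μ loss (QNN.hypothesis c O ρ θ)
            - QNN.empiricalRisk S loss (QNN.hypothesis c O ρ θ)
          ≤ 8 * (L₁ : ℝ) / √n
            + 24 * (L₁ : ℝ) / √n * ((d : ℝ) ^ k * √c.numTrainable)
                * (QNN.opNorm O * (max 0 (log (7 * √n * c.numTrainable * QNN.opNorm O)) + 1))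
            + 3 * C₁ * √(log (1 / δ) / (2 * n)) := by
  have hO : 0 ≤ QNN.opNorm O := norm_nonneg _
  set t := √n * c.numTrainable * QNN.opNorm O with ht
  have hresolution : 4 * (c.numTrainable * QNN.opNorm O) / max t 1 ≤ 4 / √n := by
    rw [div_le_div_iff₀ (by positivity) (by positivity)]
    linarith [le_max_left t 1]
  have hentropy := QNN.sqrt_two_mul_log_one_add_max_one_le (g := c.numTrainable)
    (D := (d : ℝ) ^ k) (by positivity) (by positivity) t
  obtain ⟨E, hE, hE_prob, hgap⟩ := QNN.exists_measurableSet_expectedRisk_sub_empiricalRisk_le c hd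
    hn O hρ hρ_meas μ hloss_meas hlip hbdd hδ0 hδ1 (t := max t 1) (by positivity)
  refine ⟨E, hE, hE_prob, fun S hS θ => (hgap S hS θ).trans ?_⟩
  rw [sqrt_div' _ (by positivity)]
  calc 2 * (L₁ * (4 * (c.numTrainable * QNN.opNorm O) / max t 1)) + _ + _
      ≤ 2 * (L₁ * (4 / √n)) + 4 * (L₁ * QNN.opNorm O) *
          (6 * (d ^ k * √c.numTrainable) * (max 0 (log (7 * t)) + 1) / √n) +
          3 * C₁ * √(log (1 / δ) / (2 * n)) := by
        gcongr
    _ = _ := by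
      rw [ht, ← mul_assoc 7, ← mul_assoc 7]
      ring

theorem theorem2
    {d N k Ng n : ℕ} (hd : 1 ≤ d) (hn : 1 ≤ n)
    {Θ X Y : Type*} [MeasurableSpace X] [MeasurableSpace Y]
    -- the circuit, the observable, and the encoding of data into states
    (c : QNN.Ansatz d N k Ng Θ)
    (O : QNN.Operator d N) (hO : O.IsHermitian)
    (ρ : X → QNN.Operator d N) (hρ : ∀ x, QNN.IsState (ρ x))
    (hρ_meas : ∀ a b, Measurable fun x => ρ x a b)
    -- the data distribution
    (μ : Measure (X × Y)) [IsProbabilityMeasure μ]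
    -- the loss, Lipschitz and bounded on the range of the hypotheses
    (loss : ℝ → Y → ℝ) (hloss_meas : Measurable (Function.uncurry loss))
    (L₁ : NNReal) (C₁ : ℝ)
    (hlip : ∀ y, LipschitzOnWith L₁ (fun t => loss t y)
      (Set.Icc (-QNN.opNorm O) (QNN.opNorm O)))
    (hbdd : ∀ y, ∀ t ∈ Set.Icc (-QNN.opNorm O) (QNN.opNorm O), |loss t y| ≤ C₁)
    (δ : ℝ) (hδ0 : 0 < δ) (hδ1 : δ < 1) :
    ∃ E : Set (Fin n → X × Y), MeasurableSet E ∧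
      ENNReal.ofReal (1 - δ) ≤ (Measure.pi fun _ : Fin n => μ) E ∧
      ∀ S ∈ E, ∀ A : (Fin n → X × Y) → Θ,
        QNN.expectedRisk μ loss (QNN.hypothesis c O ρ (A S))
            - QNN.empiricalRisk S loss (QNN.hypothesis c O ρ (A S))
          ≤ 8 * (L₁ : ℝ) / Real.sqrt n
            + 24 * (L₁ : ℝ) / Real.sqrt n * ((d : ℝ) ^ k * Real.sqrt c.numTrainable)
                * (max 1 (QNN.opNorm O)
                  * (max 0 (Real.log (7 * Real.sqrt n * c.numTrainable * QNN.opNorm O)) + 1))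
            + 3 * C₁ * Real.sqrt (Real.log (1 / δ) / (2 * n)) := by
  obtain ⟨E, hE, hE_prob, hgap⟩ :=
    theorem2_general hd hn c O ρ hρ hρ_meas μ loss hloss_meas L₁ C₁ hlip hbdd δ hδ0 hδ1.le
  exact ⟨E, hE, hE_prob, fun S hS A => (hgap S hS (A S)).trans (by gcongr; exact le_max_right _ _)⟩
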